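/- Let $\mathcal S$ be a field, whose elements are called scalars. The propositions are $A ::= \top \mid \bot \mid A\Rightarrow A\mid A\wedge A\mid A\vee A$, and $\mathcal V$ is the smallest set of propositions that contains $\top$ and contains $A\wedge B$ whenever it contains $A$ and $B$. The proof-terms, taken modulo renaming of bound variables, are $$t ::= x\mid t+u\mid a\bullet t\mid a.\star\mid \delta_\top(t,u)\mid \delta_\bot(t)\mid \lambda[x]t\mid t\,u\mid \langle t,u\rangle\mid \delta^1_\wedge(t,[x]u)\mid\delta^2_\wedge(t,[x]u)\mid \mathrm{inl}(t)\mid\mathrm{inr}(t)\mid\delta_\vee(t,[x]u,[y]v)$$ with $a\in\mathcal S$, where $[x]$ binds $x$ in the term that follows. The judgement $\Gamma\vdash t:A$, where $\Gamma$ is a finite set of declarations of distinct variables and $\Gamma,\Delta$ denotes a union of contexts that declare no common variable, is defined inductively by the following (linear) rules. * $x:A\vdash x:A$, and $\vdash a.\star:\top$. * If $\Gamma\vdash t:A$ and $\Gamma\vdash u:A$, then $\Gamma\vdash t+u:A$. If $\Gamma\vdash t:A$, then $\Gamma\vdash a\bullet t:A$. * If $\Gamma\vdash t:\top$ and $\Delta\vdash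 u:A$, then $\Gamma,\Delta\vdash\delta_\top(t,u):A$. If $\Gamma\vdash t:\bot$, then $\Gamma,\Delta\vdash\delta_\bot(t):C$. * If $\Gamma,x:A\vdash t:B$, then $\Gamma\vdash\lambda[x]t:A\Rightarrow B$. If $\Gamma\vdash t:A\Rightarrow B$ and $\Delta\vdash u:A$, then $\Gamma,\Delta\vdash t\,u:B$. * If $\Gamma\vdash t:A$ and $\Gamma\vdash u:B$, then $\Gamma\vdash\langle t,u\rangle:A\wedge B$. If $\Gamma\vdash t:A_1\wedge A_2$ and $\Delta,x:A_i\vdash u:C$, then $\Gamma,\Delta\vdash\delta^i_\wedge(t,[x]u):C$, for $i=1,2$. * If $\Gamma\vdash t:A$, then $\Gamma\vdash\mathrm{inl}(t):A\vee B$. If $\Gamma\vdash t:B$, then $\Gamma\vdash\mathrm{inr}(t):A\vee B$. If $\Gamma\vdash t:A\vee B$, $\Delta,x:A\vdash u:C$ and $\Delta,y:B\vdash v:C$, then $\Gamma,\Delta\vdash\delta_\vee(t,[x]u,[y]v):C$. A closed proof of $A$ is a closed proof-term $t$ such that $\vdash t:A$. The relation $\longrightarrow$ is the closure under all term formers (including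 under binders) of the rules below, where $(u/x)t$ denotes the capture-avoiding substitution of $u$ for $x$ in $t$: $$\begin{aligned} \delta_\top(a.\star,t)&\longrightarrow a\bullet t & a.\star+b.\star&\longrightarrow(a+b).\star\\ (\lambda[x]t)\,u&\longrightarrow(u/x)t & \lambda[x]t+\lambda[x]u&\longrightarrow\lambda[x](t+u)\\ \delta^1_\wedge(\langle t,u\rangle,[x]v)&\longrightarrow(t/x)v & \langle t,u\rangle+\langle v,w\rangle&\longrightarrow\langle t+v,u+w\rangle\\ \delta^2_\wedge(\langle t,u\rangle,[x]v)&\longrightarrow(u/x)v & \delta_\vee(t+u,[x]v,[y]w)&\longrightarrow\delta_\vee(t,[x]v,[y]w)+\delta_\vee(u,[x]v,[y]w)\\ \delta_\vee(\mathrm{inl}(t),[x]v,[y]w)&\longrightarrow(t/x)v & a\bullet b.\star&\longrightarrow(a\times b).\star\\ \delta_\vee(\mathrm{inr}(u),[x]v,[y]w)&\longrightarrow(u/y)w & a\bullet\lambda[x]t&\longrightarrow\lambda[x](a\bullet t)\\ && a\bullet\langle t,u\rangle&\longrightarrow\langle a\bullet t,a\bullet u\rangle\\ && \delta_\vee(a\bullet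 t,[x]v,[y]w)&\longrightarrow a\bullet\delta_\vee(t,[x]v,[y]w) \end{aligned}$$ and $\equiv$ is the reflexive-symmetric-transitive closure of $\longrightarrow$. **Statement.** Let $A$ be a proposition, let $B\in\mathcal V$, let $t$ be a closed proof of $A\Rightarrow B$, and let $u$ and $v$ be closed proofs of $A$. Then $$t\,(u+v)\equiv(t\,u)+(t\,v),\qquad\text{and, for every } a\in\mathcal S,\qquad t\,(a\bullet u)\equiv a\bullet(t\,u).$$ -/

import Mathlib

namespace LS

universe w

/-- Propositions: `⊤`, `⊥`, `A ⇒ B`, `A ∧ B`, `A ∨ B`. -/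
inductive Form : Type
  | top : Form
  | bot : Form
  | imp : Form → Form → Form
  | and : Form → Form → Form
  | or : Form → Form → Form

/-- The set `𝒱` of propositions built from `⊤` with `∧`. -/
inductive Form.IsVec : Form → Prop
  | top : Form.IsVec Form.top
  | and {A B : Form} : Form.IsVec A → Form.IsVec B → Form.IsVec (Form.and A B)

/-- Proof-terms, modulo renaming of bound variables, whose free variables are among `n` given
ones (well-scoped de Bruijn syntax). A subterm of type `Term S (n + 1)` is the scope of a binder,
whose bound variable is the index `0`. Closed proof-terms are the elements of `Term S 0`. -/
inductive Term (S : Type w) : ℕ → Type w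
  /-- a variable -/
  | var {n : ℕ} : Fin n → Term S n
  /-- the sum of two proof-terms -/
  | plus {n : ℕ} : Term S n → Term S n → Term S n
  /-- the product `a • t` of a proof-term by a scalar -/
  | prod {n : ℕ} : S → Term S n → Term S n
  /-- `a.⋆` -/
  | star {n : ℕ} : S → Term S n
  /-- `δ_⊤(t, u)` -/
  | elimTop {n : ℕ} : Term S n → Term S n → Term S n
  /-- `δ_⊥(t)` -/
  | elimBot {n : ℕ} : Term S n → Term S n
  /-- `λ[x] t` -/
  | lam {n : ℕ} : Term S (n + 1) → Term S n
  /-- `t u` -/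
  | app {n : ℕ} : Term S n → Term S n → Term S n
  /-- the pair of `t` and `u` -/
  | pair {n : ℕ} : Term S n → Term S n → Term S n
  /-- `δ_∧¹(t, [x] u)` -/
  | elimAnd1 {n : ℕ} : Term S n → Term S (n + 1) → Term S n
  /-- `δ_∧²(t, [x] u)` -/
  | elimAnd2 {n : ℕ} : Term S n → Term S (n + 1) → Term S n
  /-- `inl(t)` -/
  | inl {n : ℕ} : Term S n → Term S n
  /-- `inr(t)` -/
  | inr {n : ℕ} : Term S n → Term S n
  /-- `δ_∨(t, [x] u, [y] v)` -/
  | elimOr {n : ℕ} : Term S n → Term S (n + 1) → Term S (n + 1) → Term S n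

namespace Term

variable {S : Type w}

/-- A renaming extended below a binder. -/
def liftRen {n m : ℕ} (f : Fin n → Fin m) : Fin (n + 1) → Fin (m + 1) :=
  Fin.cases 0 (fun i => (f i).succ)

/-- Renaming of the free variables. -/
def rename : {n m : ℕ} → (Fin n → Fin m) → Term S n → Term S m
  | _, _, f, var i => var (f i)
  | _, _, f, plus t u => plus (rename f t) (rename f u)
  | _, _, f, prod a t => prod a (rename f t)
  | _, _, _, star a => star a
  | _, _, f, elimTop t u => elimTop (rename f t) (rename f u)
  | _, _, f, elimBot t => elimBot (rename f t)
  | _, _, f, lam t => lam (rename (liftRen f) t)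
  | _, _, f, app t u => app (rename f t) (rename f u)
  | _, _, f, pair t u => pair (rename f t) (rename f u)
  | _, _, f, elimAnd1 t u => elimAnd1 (rename f t) (rename (liftRen f) u)
  | _, _, f, elimAnd2 t u => elimAnd2 (rename f t) (rename (liftRen f) u)
  | _, _, f, inl t => inl (rename f t)
  | _, _, f, inr t => inr (rename f t)
  | _, _, f, elimOr t u v =>
      elimOr (rename f t) (rename (liftRen f) u) (rename (liftRen f) v)

/-- A substitution extended below a binder. -/
def liftSubst {n m : ℕ} (s : Fin n → Term S m) : Fin (n + 1) → Term S (m + 1) :=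
  Fin.cases (var 0) (fun i => rename Fin.succ (s i))

/-- Simultaneous capture-avoiding substitution. -/
def subst : {n m : ℕ} → (Fin n → Term S m) → Term S n → Term S m
  | _, _, s, var i => s i
  | _, _, s, plus t u => plus (subst s t) (subst s u)
  | _, _, s, prod a t => prod a (subst s t)
  | _, _, _, star a => star a
  | _, _, s, elimTop t u => elimTop (subst s t) (subst s u)
  | _, _, s, elimBot t => elimBot (subst s t)
  | _, _, s, lam t => lam (subst (liftSubst s) t)
  | _, _, s, app t u => app (subst s t) (subst s u)
  | _, _, s, pair t u => pair (subst s t) (subst s u)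
  | _, _, s, elimAnd1 t u => elimAnd1 (subst s t) (subst (liftSubst s) u)
  | _, _, s, elimAnd2 t u => elimAnd2 (subst s t) (subst (liftSubst s) u)
  | _, _, s, inl t => inl (subst s t)
  | _, _, s, inr t => inr (subst s t)
  | _, _, s, elimOr t u v =>
      elimOr (subst s t) (subst (liftSubst s) u) (subst (liftSubst s) v)

/-- `(u/x) t`, where `x` is the variable `0` of `t`. -/
def inst {n : ℕ} (t : Term S (n + 1)) (u : Term S n) : Term S n :=
  subst (Fin.cases u var) t

end Term

open Term in
/-- One-step reduction: the fourteen reduction rules, closed under all term formers. -/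
inductive Step {S : Type w} [Field S] : {n : ℕ} → Term S n → Term S n → Prop
  -- reduction of cuts
  | top_beta {n : ℕ} (a : S) (t : Term S n) : Step (elimTop (star a) t) (prod a t)
  | imp_beta {n : ℕ} (t : Term S (n + 1)) (u : Term S n) : Step (app (lam t) u) (t.inst u)
  | and1_beta {n : ℕ} (t u : Term S n) (v : Term S (n + 1)) :
      Step (elimAnd1 (pair t u) v) (v.inst t)
  | and2_beta {n : ℕ} (t u : Term S n) (v : Term S (n + 1)) :
      Step (elimAnd2 (pair t u) v) (v.inst u)
  | inl_beta {n : ℕ} (t : Term S n) (v w : Term S (n + 1)) :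
      Step (elimOr (inl t) v w) (v.inst t)
  | inr_beta {n : ℕ} (u : Term S n) (v w : Term S (n + 1)) :
      Step (elimOr (inr u) v w) (w.inst u)
  -- commutation of the sum
  | plus_star {n : ℕ} (a b : S) : Step (plus (star a) (star b) : Term S n) (star (a + b))
  | plus_lam {n : ℕ} (t u : Term S (n + 1)) : Step (plus (lam t) (lam u)) (lam (plus t u))
  | plus_pair {n : ℕ} (t u v w : Term S n) :
      Step (plus (pair t u) (pair v w)) (pair (plus t v) (plus u w))
  | or_plus {n : ℕ} (t u : Term S n) (v w : Term S (n + 1)) :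
      Step (elimOr (plus t u) v w) (plus (elimOr t v w) (elimOr u v w))
  -- commutation of the product by a scalar
  | prod_star {n : ℕ} (a b : S) : Step (prod a (star b) : Term S n) (star (a * b))
  | prod_lam {n : ℕ} (a : S) (t : Term S (n + 1)) : Step (prod a (lam t)) (lam (prod a t))
  | prod_pair {n : ℕ} (a : S) (t u : Term S n) :
      Step (prod a (pair t u)) (pair (prod a t) (prod a u))
  | or_prod {n : ℕ} (a : S) (t : Term S n) (v w : Term S (n + 1)) :
      Step (elimOr (prod a t) v w) (prod a (elimOr t v w))
  -- reduction inside a proof-term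
  | plus_left {n : ℕ} {t t' u : Term S n} : Step t t' → Step (plus t u) (plus t' u)
  | plus_right {n : ℕ} {t u u' : Term S n} : Step u u' → Step (plus t u) (plus t u')
  | prod_arg {n : ℕ} {a : S} {t t' : Term S n} : Step t t' → Step (prod a t) (prod a t')
  | elimTop_left {n : ℕ} {t t' u : Term S n} : Step t t' → Step (elimTop t u) (elimTop t' u)
  | elimTop_right {n : ℕ} {t u u' : Term S n} : Step u u' → Step (elimTop t u) (elimTop t u')
  | elimBot_arg {n : ℕ} {t t' : Term S n} : Step t t' → Step (elimBot t) (elimBot t')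
  | lam_body {n : ℕ} {t t' : Term S (n + 1)} : Step t t' → Step (lam t) (lam t')
  | app_left {n : ℕ} {t t' u : Term S n} : Step t t' → Step (app t u) (app t' u)
  | app_right {n : ℕ} {t u u' : Term S n} : Step u u' → Step (app t u) (app t u')
  | pair_left {n : ℕ} {t t' u : Term S n} : Step t t' → Step (pair t u) (pair t' u)
  | pair_right {n : ℕ} {t u u' : Term S n} : Step u u' → Step (pair t u) (pair t u')
  | elimAnd1_left {n : ℕ} {t t' : Term S n} {u : Term S (n + 1)} :
      Step t t' → Step (elimAnd1 t u) (elimAnd1 t' u)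
  | elimAnd1_body {n : ℕ} {t : Term S n} {u u' : Term S (n + 1)} :
      Step u u' → Step (elimAnd1 t u) (elimAnd1 t u')
  | elimAnd2_left {n : ℕ} {t t' : Term S n} {u : Term S (n + 1)} :
      Step t t' → Step (elimAnd2 t u) (elimAnd2 t' u)
  | elimAnd2_body {n : ℕ} {t : Term S n} {u u' : Term S (n + 1)} :
      Step u u' → Step (elimAnd2 t u) (elimAnd2 t u')
  | inl_arg {n : ℕ} {t t' : Term S n} : Step t t' → Step (inl t) (inl t')
  | inr_arg {n : ℕ} {t t' : Term S n} : Step t t' → Step (inr t) (inr t')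
  | elimOr_left {n : ℕ} {t t' : Term S n} {u v : Term S (n + 1)} :
      Step t t' → Step (elimOr t u v) (elimOr t' u v)
  | elimOr_body1 {n : ℕ} {t : Term S n} {u u' v : Term S (n + 1)} :
      Step u u' → Step (elimOr t u v) (elimOr t u' v)
  | elimOr_body2 {n : ℕ} {t : Term S n} {u v v' : Term S (n + 1)} :
      Step v v' → Step (elimOr t u v) (elimOr t u v')

/-- Convertibility `t ≡ u`: the reflexive-symmetric-transitive closure of reduction. -/
def Conv {S : Type w} [Field S] {n : ℕ} (t u : Term S n) : Prop :=
  Relation.EqvGen Step t u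

/-- A context over `n` variables: each variable is declared with a proposition (`some A`), or is
not declared (`none`). -/
abbrev Ctx (n : ℕ) : Type := Fin n → Option Form

namespace Ctx

/-- The context without declarations. -/
def empty {n : ℕ} : Ctx n := fun _ => none

/-- The context `x : A`. -/
def single {n : ℕ} (x : Fin n) (A : Form) : Ctx n := fun y => if y = x then some A else none

/-- The context `Γ, x : A`, where `x` is the newly bound variable `0`. -/
def cons {n : ℕ} (A : Form) (Γ : Ctx n) : Ctx (n + 1) :=
  Fin.cases (motive := fun _ => Option Form) (some A) Γ

/-- `Split Θ Γ Δ` says that `Θ` is the (disjoint) union `Γ, Δ`: every variable is undeclared in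
one of `Γ` and `Δ`, and has in `Θ` its declaration from the other one. -/
def Split {n : ℕ} (Θ Γ Δ : Ctx n) : Prop :=
  ∀ x, (Δ x = none ∧ Θ x = Γ x) ∨ (Γ x = none ∧ Θ x = Δ x)

end Ctx

open Term in
/-- The typing judgement `Γ ⊢ t : A`. -/
inductive Typed {S : Type w} : {n : ℕ} → Ctx n → Term S n → Form → Prop
  | ax {n : ℕ} (x : Fin n) (A : Form) : Typed (Ctx.single x A) (var x) A
  | sum {n : ℕ} {Γ : Ctx n} {t u : Term S n} {A : Form} :
      Typed Γ t A → Typed Γ u A → Typed Γ (plus t u) A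
  | prod {n : ℕ} {Γ : Ctx n} (a : S) {t : Term S n} {A : Form} :
      Typed Γ t A → Typed Γ (prod a t) A
  | top_i {n : ℕ} (a : S) : Typed (Ctx.empty : Ctx n) (star a) Form.top
  | top_e {n : ℕ} {Θ Γ Δ : Ctx n} {t u : Term S n} {A : Form} : Ctx.Split Θ Γ Δ →
      Typed Γ t Form.top → Typed Δ u A → Typed Θ (elimTop t u) A
  | bot_e {n : ℕ} {Θ Γ Δ : Ctx n} {t : Term S n} {C : Form} : Ctx.Split Θ Γ Δ →
      Typed Γ t Form.bot → Typed Θ (elimBot t) C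
  | imp_i {n : ℕ} {Γ : Ctx n} {t : Term S (n + 1)} {A B : Form} :
      Typed (Ctx.cons A Γ) t B → Typed Γ (lam t) (Form.imp A B)
  | imp_e {n : ℕ} {Θ Γ Δ : Ctx n} {t u : Term S n} {A B : Form} : Ctx.Split Θ Γ Δ →
      Typed Γ t (Form.imp A B) → Typed Δ u A → Typed Θ (app t u) B
  | and_i {n : ℕ} {Γ : Ctx n} {t u : Term S n} {A B : Form} :
      Typed Γ t A → Typed Γ u B → Typed Γ (pair t u) (Form.and A B)
  | and_e1 {n : ℕ} {Θ Γ Δ : Ctx n} {t : Term S n} {u : Term S (n + 1)} {A B C : Form} :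
      Ctx.Split Θ Γ Δ → Typed Γ t (Form.and A B) → Typed (Ctx.cons A Δ) u C →
      Typed Θ (elimAnd1 t u) C
  | and_e2 {n : ℕ} {Θ Γ Δ : Ctx n} {t : Term S n} {u : Term S (n + 1)} {A B C : Form} :
      Ctx.Split Θ Γ Δ → Typed Γ t (Form.and A B) → Typed (Ctx.cons B Δ) u C →
      Typed Θ (elimAnd2 t u) C
  | or_i1 {n : ℕ} {Γ : Ctx n} {t : Term S n} {A B : Form} :
      Typed Γ t A → Typed Γ (inl t) (Form.or A B)
  | or_i2 {n : ℕ} {Γ : Ctx n} {t : Term S n} {A B : Form} :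
      Typed Γ t B → Typed Γ (inr t) (Form.or A B)
  | or_e {n : ℕ} {Θ Γ Δ : Ctx n} {t : Term S n} {u v : Term S (n + 1)} {A B C : Form} :
      Ctx.Split Θ Γ Δ → Typed Γ t (Form.or A B) → Typed (Ctx.cons A Δ) u C →
      Typed (Ctx.cons B Δ) v C → Typed Θ (elimOr t u v) C

/-- `t` is a closed proof of `A`: a closed proof-term with `⊢ t : A`. -/
def IsClosedProof {S : Type w} (t : Term S 0) (A : Form) : Prop :=
  Typed Ctx.empty t A

end LS

/-! Propositions are read as vector spaces: `⊤` is the field, `⇒` the space of linear maps, `∧` and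
`∨` both the product. A logical relation `Rel` links closed terms to vectors; it is stable under
conversion, sums, scalar products and application. Two facts then suffice: every closed proof is
related to some vector (`IsClosedProof.exists_rel`), and for a proposition in 𝒱 the vector
determines the term up to `≡` (`Form.IsVec.conv_of_rel`). If t, u, v are related to f, x, y, then t
(u + v) and t u + t v are both related to f (x + y) = f x + f y, hence convertible; likewise for
scalars. Neither confluence nor termination is used.

The first fact comes from the fundamental lemma `Typed.exists_realizes`. As `Rel` at an implication
demands a linear map, the induction must produce a function of the environment that is linear in
each declared variable. The linear typing rules supply this: rules that share a context combine maps
linear in the same variables, and rules that split it compose with a bilinear map. -/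

namespace LS

/-! ### Substitution calculus -/

namespace Term

variable {S : Type w}

theorem liftRen_comp {n m k : ℕ} (f : Fin n → Fin m) (g : Fin m → Fin k) :
    liftRen (g ∘ f) = liftRen g ∘ liftRen f := by
  funext i
  refine Fin.cases rfl (fun j => ?_) i
  rfl

theorem rename_rename {n : ℕ} (t : Term S n) : ∀ {m k : ℕ} (f : Fin n → Fin m)
    (g : Fin m → Fin k), rename g (rename f t) = rename (g ∘ f) t := by
  induction t <;> intro m k f g <;> simp_all [rename, liftRen_comp]

theorem liftSubst_comp_liftRen {n m k : ℕ} (f : Fin n → Fin m) (s : Fin m → Term S k) :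
    liftSubst s ∘ liftRen f = liftSubst (s ∘ f) := by
  funext i
  refine Fin.cases rfl (fun j => ?_) i
  rfl

theorem subst_rename {n : ℕ} (t : Term S n) : ∀ {m k : ℕ} (f : Fin n → Fin m)
    (s : Fin m → Term S k), subst s (rename f t) = subst (s ∘ f) t := by
  induction t <;> intro m k f s <;> simp_all [rename, subst, liftSubst_comp_liftRen]

theorem rename_comp_liftSubst {n m k : ℕ} (s : Fin n → Term S m) (f : Fin m → Fin k) :
    (fun i => rename (liftRen f) (liftSubst s i)) = liftSubst (fun i => rename f (s i)) := by
  funext i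
  refine Fin.cases rfl (fun j => ?_) i
  simp only [liftSubst, Fin.cases_succ, rename_rename]
  rfl

theorem rename_subst {n : ℕ} (t : Term S n) : ∀ {m k : ℕ} (s : Fin n → Term S m)
    (f : Fin m → Fin k), rename f (subst s t) = subst (fun i => rename f (s i)) t := by
  induction t <;> intro m k s f <;> simp_all [rename, subst, rename_comp_liftSubst]

theorem subst_comp_liftSubst {n m k : ℕ} (s : Fin n → Term S m) (r : Fin m → Term S k) :
    (fun i => subst (liftSubst r) (liftSubst s i)) = liftSubst (fun i => subst r (s i)) := by
  funext i
  refine Fin.cases rfl (fun j => ?_) i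
  simp only [liftSubst, Fin.cases_succ, rename_subst, subst_rename]
  rfl

theorem subst_subst {n : ℕ} (t : Term S n) : ∀ {m k : ℕ} (s : Fin n → Term S m)
    (r : Fin m → Term S k), subst r (subst s t) = subst (fun i => subst r (s i)) t := by
  induction t <;> intro m k s r <;> simp_all [subst, subst_comp_liftSubst]

theorem liftSubst_var {n : ℕ} : liftSubst (var : Fin n → Term S n) = var := by
  funext i
  refine Fin.cases rfl (fun j => ?_) i
  rfl

theorem subst_var {n : ℕ} (t : Term S n) : subst var t = t := by
  induction t <;> simp_all [subst, liftSubst_var]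

/-- Weakening followed by instantiation is the identity on each `s j`. This turns a statement about
the body of a binder into one about the extended substitution. -/
theorem inst_subst_liftSubst {n m : ℕ} (s : Fin n → Term S m) (t : Term S (n + 1))
    (u : Term S m) :
    (subst (liftSubst s) t).inst u =
      subst (Fin.cases (motive := fun _ => Term S m) u s) t := by
  rw [inst, subst_subst]
  congr 1
  funext i
  refine Fin.cases rfl (fun j => ?_) i
  simp only [liftSubst, Fin.cases_succ, subst_rename]
  exact subst_var (s j)

end Term

/-! ### Convertibility is a congruence -/

section Conversion

variable {S : Type w} [Field S] {n : ℕ}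

theorem Step.conv {t u : Term S n} (h : Step t u) : Conv t u := Relation.EqvGen.rel _ _ h

theorem Conv.symm {t u : Term S n} (h : Conv t u) : Conv u t := Relation.EqvGen.symm _ _ h

theorem Conv.trans {t u v : Term S n} (h : Conv t u) (h' : Conv u v) : Conv t v :=
  Relation.EqvGen.trans _ _ _ h h'

theorem Conv.map {m : ℕ} {f : Term S n → Term S m} (hf : ∀ t t', Step t t' → Step (f t) (f t'))
    {t t' : Term S n} (h : Conv t t') : Conv (f t) (f t') := by
  induction h with
  | rel _ _ h => exact (hf _ _ h).conv
  | refl => exact Relation.EqvGen.refl _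
  | symm _ _ _ ih => exact ih.symm
  | trans _ _ _ _ _ ih ih' => exact ih.trans ih'

theorem Conv.plus {t t' u u' : Term S n} (h : Conv t t') (h' : Conv u u') :
    Conv (Term.plus t u) (Term.plus t' u') :=
  (h.map (f := fun t => Term.plus t u) fun _ _ => Step.plus_left).trans
    (h'.map fun _ _ => Step.plus_right)

theorem Conv.pair {t t' u u' : Term S n} (h : Conv t t') (h' : Conv u u') :
    Conv (Term.pair t u) (Term.pair t' u') :=
  (h.map (f := fun t => Term.pair t u) fun _ _ => Step.pair_left).trans
    (h'.map fun _ _ => Step.pair_right)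

theorem Conv.prod (a : S) {t t' : Term S n} (h : Conv t t') :
    Conv (Term.prod a t) (Term.prod a t') :=
  h.map fun _ _ => Step.prod_arg

end Conversion

/-- The interpretation of propositions by vector spaces. -/
noncomputable def Sem (S : Type w) [Field S] : Form → ModuleCat.{w} S
  | Form.top => ModuleCat.of S S
  | Form.bot => ModuleCat.of S PUnit
  | Form.imp A B => ModuleCat.of S (Sem S A →ₗ[S] Sem S B)
  | Form.and A B => ModuleCat.of S (Sem S A × Sem S B)
  | Form.or A B => ModuleCat.of S (Sem S A × Sem S B)

/-! ### The logical relation -/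

section LogicalRelation

variable {S : Type w} [Field S]

/-- The closed proof-terms of a disjunction that are linear combinations of injections, related
to the corresponding linear combinations of vectors. -/
inductive OrRel {M N : Type w} [AddCommGroup M] [Module S M] [AddCommGroup N] [Module S N]
    (P : Term S 0 → M → Prop) (Q : Term S 0 → N → Prop) : Term S 0 → M × N → Prop
  | inl {t : Term S 0} {x : M} : P t x → OrRel P Q (Term.inl t) (x, 0)
  | inr {t : Term S 0} {y : N} : Q t y → OrRel P Q (Term.inr t) (0, y)
  | plus {t u : Term S 0} {p q : M × N} :
      OrRel P Q t p → OrRel P Q u q → OrRel P Q (Term.plus t u) (p + q)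
  | prod (a : S) {t : Term S 0} {p : M × N} : OrRel P Q t p → OrRel P Q (Term.prod a t) (a • p)
  | conv {t t' : Term S 0} {p : M × N} : Conv t t' → OrRel P Q t' p → OrRel P Q t p

/-- The logical relation between closed proof-terms and vectors. -/
def Rel : (A : Form) → Term S 0 → Sem S A → Prop
  | Form.top, t, a => Conv t (Term.star (show S from a))
  | Form.bot, _, _ => False
  | Form.imp A B, t, f => ∃ t' : Term S 1, Conv t (Term.lam t') ∧
      ∀ u x, Rel A u x → Rel B (t'.inst u) ((show Sem S A →ₗ[S] Sem S B from f) x)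
  | Form.and A B, t, p => ∃ t₁ t₂ : Term S 0, Conv t (Term.pair t₁ t₂) ∧
      Rel A t₁ (show Sem S A × Sem S B from p).1 ∧ Rel B t₂ (show Sem S A × Sem S B from p).2
  | Form.or A B, t, p => OrRel (Rel A) (Rel B) t (show Sem S A × Sem S B from p)

theorem Rel.conv {A : Form} {t t' : Term S 0} {x : Sem S A} (h : Conv t t') (hx : Rel A t' x) :
    Rel A t x := by
  cases A with
  | top => exact h.trans hx
  | bot => exact hx
  | imp A B => obtain ⟨w, hw, H⟩ := hx; exact ⟨w, h.trans hw, H⟩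
  | and A B => obtain ⟨t₁, t₂, hw, H⟩ := hx; exact ⟨t₁, t₂, h.trans hw, H⟩
  | or A B => exact OrRel.conv h hx

/-- Reduction pushes sums through `⋆`, `λ` and pairs, but not through injections; hence `OrRel` has
sums and scalar products as constructors. -/
theorem Rel.plus {A : Form} : ∀ {t u : Term S 0} {x y : Sem S A}, Rel A t x → Rel A u y →
    Rel A (Term.plus t u) (x + y) := by
  induction A with
  | top => intro t u x y hx hy; exact (Conv.plus hx hy).trans (Step.plus_star _ _).conv
  | bot => intro t u x y hx; exact hx.elim
  | imp A B _ ihB =>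
    rintro t u x y ⟨t', ht, hx⟩ ⟨u', hu, hy⟩
    exact ⟨Term.plus t' u', (ht.plus hu).trans (Step.plus_lam _ _).conv,
      fun w z hz => ihB (hx w z hz) (hy w z hz)⟩
  | and A B ihA ihB =>
    rintro t u x y ⟨t₁, t₂, ht, hx₁, hx₂⟩ ⟨u₁, u₂, hu, hy₁, hy₂⟩
    exact ⟨_, _, (ht.plus hu).trans (Step.plus_pair _ _ _ _).conv, ihA hx₁ hy₁, ihB hx₂ hy₂⟩
  | or A B => intro t u x y hx hy; exact OrRel.plus hx hy

theorem Rel.prod (a : S) {A : Form} : ∀ {t : Term S 0} {x : Sem S A}, Rel A t x →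
    Rel A (Term.prod a t) (a • x) := by
  induction A with
  | top => intro t x hx; exact (Conv.prod a hx).trans (Step.prod_star _ _).conv
  | bot => intro t x hx; exact hx.elim
  | imp A B _ ihB =>
    rintro t x ⟨t', ht, hx⟩
    exact ⟨Term.prod a t', (ht.prod a).trans (Step.prod_lam _ _).conv,
      fun w z hz => ihB (hx w z hz)⟩
  | and A B ihA ihB =>
    rintro t x ⟨t₁, t₂, ht, hx₁, hx₂⟩
    exact ⟨_, _, (ht.prod a).trans (Step.prod_pair _ _ _).conv, ihA hx₁, ihB hx₂⟩
  | or A B => intro t x hx; exact OrRel.prod a hx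

theorem Rel.app {A B : Form} {t u : Term S 0} {f : Sem S A →ₗ[S] Sem S B} {x : Sem S A}
    (ht : Rel (Form.imp A B) t f) (hu : Rel A u x) : Rel B (Term.app t u) (f x) := by
  obtain ⟨t', h, H⟩ := ht
  exact Rel.conv ((h.map (f := fun t => Term.app t u) fun _ _ => Step.app_left).trans
    (Step.imp_beta _ _).conv) (H u x hu)

theorem Rel.elimTop {A : Form} {t u : Term S 0} {a : S} {x : Sem S A}
    (ht : Rel Form.top t a) (hu : Rel A u x) : Rel A (Term.elimTop t u) (a • x) :=
  Rel.conv ((Conv.map (f := fun t => Term.elimTop t u) (fun _ _ => Step.elimTop_left) ht).trans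
    (Step.top_beta _ _).conv) (hu.prod a)

theorem Rel.elimAnd1 {A B C : Form} {t : Term S 0} {v : Term S 1} {p : Sem S A × Sem S B}
    {f : Sem S A →ₗ[S] Sem S C} (ht : Rel (Form.and A B) t p)
    (hv : ∀ u x, Rel A u x → Rel C (v.inst u) (f x)) : Rel C (Term.elimAnd1 t v) (f p.1) := by
  obtain ⟨t₁, t₂, h, h₁, _⟩ := ht
  exact Rel.conv ((h.map (f := fun t => Term.elimAnd1 t v) fun _ _ => Step.elimAnd1_left).trans
    (Step.and1_beta _ _ _).conv) (hv _ _ h₁)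

theorem Rel.elimAnd2 {A B C : Form} {t : Term S 0} {v : Term S 1} {p : Sem S A × Sem S B}
    {f : Sem S B →ₗ[S] Sem S C} (ht : Rel (Form.and A B) t p)
    (hv : ∀ u x, Rel B u x → Rel C (v.inst u) (f x)) : Rel C (Term.elimAnd2 t v) (f p.2) := by
  obtain ⟨t₁, t₂, h, _, h₂⟩ := ht
  exact Rel.conv ((h.map (f := fun t => Term.elimAnd2 t v) fun _ _ => Step.elimAnd2_left).trans
    (Step.and2_beta _ _ _).conv) (hv _ _ h₂)

/-- The scrutinee is, up to conversion, only a linear combination of injections. Commuting `δ_∨`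
with sums and scalars mirrors the linearity of `f.coprod g`. -/
theorem Rel.elimOr {A B C : Form} {t : Term S 0} {v w : Term S 1} {p : Sem S A × Sem S B}
    {f : Sem S A →ₗ[S] Sem S C} {g : Sem S B →ₗ[S] Sem S C} (ht : Rel (Form.or A B) t p)
    (hv : ∀ u x, Rel A u x → Rel C (v.inst u) (f x))
    (hw : ∀ u x, Rel B u x → Rel C (w.inst u) (g x)) :
    Rel C (Term.elimOr t v w) (f.coprod g p) := by
  have ht' : OrRel (Rel A) (Rel B) t p := ht
  clear ht
  induction ht' with
  | inl h => simpa using Rel.conv (Step.inl_beta _ _ _).conv (hv _ _ h)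
  | inr h => simpa using Rel.conv (Step.inr_beta _ _ _).conv (hw _ _ h)
  | plus _ _ ih ih' =>
    rw [map_add]
    exact Rel.conv (Step.or_plus _ _ _ _).conv (ih.plus ih')
  | prod a _ ih =>
    rw [map_smul]
    exact Rel.conv (Step.or_prod _ _ _ _).conv (ih.prod a)
  | conv h _ ih =>
    exact Rel.conv (h.map (f := fun t => Term.elimOr t v w) fun _ _ => Step.elimOr_left) ih

/-- At `⊤` and `∧` the relation pins down the term itself, whereas at `⇒` it only constrains how the
body acts on related arguments. -/
theorem Form.IsVec.conv_of_rel {B : Form} (hB : B.IsVec) : ∀ {t u : Term S 0} {x : Sem S B},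
    Rel B t x → Rel B u x → Conv t u := by
  induction hB with
  | top => intro t u x ht hu; exact Conv.trans ht (Conv.symm hu)
  | and _ _ ihA ihB =>
    rintro t u x ⟨t₁, t₂, ht, ht₁, ht₂⟩ ⟨u₁, u₂, hu, hu₁, hu₂⟩
    exact ht.trans (((ihA ht₁ hu₁).pair (ihB ht₂ hu₂)).trans hu.symm)

end LogicalRelation

/-! ### Multilinear functions of environments -/

section Multilinear

variable {S : Type w} [Field S]

/-- Environments over `n` variables, giving for each variable a vector of every proposition. -/
abbrev Env (S : Type w) [Field S] (n : ℕ) : Type w := Fin n → ∀ A, Sem S A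

open scoped Classical in
/-- The extension of an environment by a vector of `A`. -/
noncomputable def Env.cons {n : ℕ} {A : Form} (x : Sem S A) (ρ : Env S n) : Env S (n + 1) :=
  Fin.cons (α := fun _ => ∀ B, Sem S B) (Pi.single A x) ρ

/-- `F` depends only on the variables declared in `Γ`, and is linear in each of them. -/
structure IsMultilinearOn {n : ℕ} {M : Type*} [AddCommGroup M] [Module S M] (Γ : Ctx n)
    (F : Env S n → M) : Prop where
  indep : ∀ ρ x e, Γ x = none → F (Function.update ρ x e) = F ρ
  add : ∀ ρ x e e', Γ x ≠ none → F (Function.update ρ x (e + e')) =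
    F (Function.update ρ x e) + F (Function.update ρ x e')
  smul : ∀ ρ x (a : S) e, Γ x ≠ none → F (Function.update ρ x (a • e)) =
    a • F (Function.update ρ x e)

namespace IsMultilinearOn

variable {n : ℕ} {M N P : Type*} [AddCommGroup M] [Module S M] [AddCommGroup N] [Module S N]
  [AddCommGroup P] [Module S P] {Θ Γ Δ : Ctx n} {F G : Env S n → M}

theorem zero : IsMultilinearOn Γ (fun _ : Env S n => (0 : M)) :=
  ⟨fun _ _ _ _ => rfl, fun _ _ _ _ _ => (add_zero 0).symm, fun _ _ _ _ _ => (smul_zero _).symm⟩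

theorem fun_add (hF : IsMultilinearOn Γ F) (hG : IsMultilinearOn Γ G) :
    IsMultilinearOn Γ (fun ρ => F ρ + G ρ) where
  indep ρ x e h := by rw [hF.indep ρ x e h, hG.indep ρ x e h]
  add ρ x e e' h := by rw [hF.add ρ x e e' h, hG.add ρ x e e' h]; abel
  smul ρ x a e h := by rw [hF.smul ρ x a e h, hG.smul ρ x a e h, smul_add]

theorem comp (hF : IsMultilinearOn Γ F) (f : M →ₗ[S] N) :
    IsMultilinearOn Γ (fun ρ => f (F ρ)) where
  indep ρ x e h := by rw [hF.indep ρ x e h]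
  add ρ x e e' h := by rw [hF.add ρ x e e' h, map_add]
  smul ρ x a e h := by rw [hF.smul ρ x a e h, map_smul]

theorem prodMk {G : Env S n → N} (hF : IsMultilinearOn Γ F) (hG : IsMultilinearOn Γ G) :
    IsMultilinearOn Γ (fun ρ => (F ρ, G ρ)) where
  indep ρ x e h := by rw [hF.indep ρ x e h, hG.indep ρ x e h]
  add ρ x e e' h := by rw [hF.add ρ x e e' h, hG.add ρ x e e' h, Prod.mk_add_mk]
  smul ρ x a e h := by rw [hF.smul ρ x a e h, hG.smul ρ x a e h, Prod.smul_mk]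

/-- The contexts are disjoint, so varying one variable moves only one argument of `f`, and linearity
in that argument is enough. -/
theorem bilin {G : Env S n → N} (hF : IsMultilinearOn Γ F) (hG : IsMultilinearOn Δ G)
    (h : Ctx.Split Θ Γ Δ) (f : M →ₗ[S] N →ₗ[S] P) :
    IsMultilinearOn Θ (fun ρ => f (F ρ) (G ρ)) where
  indep ρ x e hx := by
    rcases h x with ⟨h₁, h₂⟩ | ⟨h₁, h₂⟩
    · rw [hF.indep ρ x e (h₂ ▸ hx), hG.indep ρ x e h₁]
    · rw [hF.indep ρ x e h₁, hG.indep ρ x e (h₂ ▸ hx)]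
  add ρ x e e' hx := by
    rcases h x with ⟨h₁, h₂⟩ | ⟨h₁, h₂⟩
    · simp only [hG.indep _ x _ h₁, hF.add ρ x e e' (h₂ ▸ hx), map_add, LinearMap.add_apply]
    · simp only [hF.indep _ x _ h₁, hG.add ρ x e e' (h₂ ▸ hx), map_add]
  smul ρ x a e hx := by
    rcases h x with ⟨h₁, h₂⟩ | ⟨h₁, h₂⟩
    · simp only [hG.indep _ x _ h₁, hF.smul ρ x a e (h₂ ▸ hx), map_smul, LinearMap.smul_apply]
    · simp only [hF.indep _ x _ h₁, hG.smul ρ x a e (h₂ ▸ hx), map_smul]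

theorem var (x : Fin n) (A : Form) :
    IsMultilinearOn (Ctx.single x A) (fun ρ : Env S n => ρ x A) where
  indep ρ y e hy := by
    have : x ≠ y := by rintro rfl; simp [Ctx.single] at hy
    rw [Function.update_of_ne this]
  add ρ y e e' hy := by
    have : y = x := by by_contra h; simp [Ctx.single, h] at hy
    subst this; simp
  smul ρ y a e hy := by
    have : y = x := by by_contra h; simp [Ctx.single, h] at hy
    subst this; simp

open scoped Classical in
-- Interprets binders: linearity in variable 0 gives the linear map, the other variables stay
-- parameters.
theorem curry {A : Form} {F : Env S (n + 1) → M} (hF : IsMultilinearOn (Ctx.cons A Γ) F) :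
    ∃ G : Env S n → (Sem S A →ₗ[S] M), IsMultilinearOn Γ G ∧
      ∀ ρ x, G ρ x = F (Env.cons x ρ) := by
  have h0 : Ctx.cons A Γ 0 ≠ none := Option.some_ne_none A
  refine ⟨fun ρ =>
    { toFun := fun x => F (Env.cons x ρ)
      map_add' := fun x y => ?_
      map_smul' := fun a x => ?_ }, ⟨?_, ?_, ?_⟩, fun _ _ => rfl⟩
  · have := hF.add (Env.cons (0 : Sem S A) ρ) 0 (Pi.single A x) (Pi.single A y) h0
    simpa only [Env.cons, Fin.update_cons_zero, ← Pi.single_add] using this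
  · have := hF.smul (Env.cons (0 : Sem S A) ρ) 0 a (Pi.single A x) h0
    simpa only [Env.cons, Fin.update_cons_zero, ← Pi.single_smul, RingHom.id_apply] using this
  · intro ρ x e hx
    ext y
    have := hF.indep (Env.cons y ρ) x.succ e hx
    simp only [Env.cons, ← Fin.cons_update] at this
    exact this
  · intro ρ x e e' hx
    ext y
    have := hF.add (Env.cons y ρ) x.succ e e' hx
    simp only [Env.cons, ← Fin.cons_update] at this
    exact this
  · intro ρ x a e hx
    ext y
    have := hF.smul (Env.cons y ρ) x.succ a e hx
    simp only [Env.cons, ← Fin.cons_update] at this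
    exact this

end IsMultilinearOn

end Multilinear

/-! ### The fundamental lemma -/

section FundamentalLemma

variable {S : Type w} [Field S]

/-- The substitution `s` and the environment `ρ` are related on the variables declared in `Γ`. -/
def EnvRel {n : ℕ} (Γ : Ctx n) (s : Fin n → Term S 0) (ρ : Env S n) : Prop :=
  ∀ x A, Γ x = some A → Rel A (s x) (ρ x A)

theorem EnvRel.cons {n : ℕ} {Γ : Ctx n} {s : Fin n → Term S 0} {ρ : Env S n} (h : EnvRel Γ s ρ)
    {A : Form} {u : Term S 0} {x : Sem S A} (hu : Rel A u x) :
    EnvRel (Ctx.cons A Γ) (Fin.cases (motive := fun _ => Term S 0) u s) (Env.cons x ρ) := by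
  intro y
  refine Fin.cases ?_ (fun z => ?_) y
  · intro B hB
    obtain rfl : A = B := Option.some.inj hB
    simpa [Env.cons] using hu
  · exact fun B hB => h z B hB

theorem Ctx.Split.envRel {n : ℕ} {Θ Γ Δ : Ctx n} {s : Fin n → Term S 0} {ρ : Env S n}
    (h : Ctx.Split Θ Γ Δ) (hs : EnvRel Θ s ρ) : EnvRel Γ s ρ ∧ EnvRel Δ s ρ := by
  constructor <;> intro x A hx <;> rcases h x with ⟨h₁, h₂⟩ | ⟨h₁, h₂⟩
  · exact hs x A (h₂.trans hx)
  · simp [h₁] at hx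
  · simp [h₁] at hx
  · exact hs x A (h₂.trans hx)

/-- `F` realises `t : A` in context `Γ`. -/
def Realizes {n : ℕ} (Γ : Ctx n) (t : Term S n) (A : Form) (F : Env S n → Sem S A) : Prop :=
  ∀ s ρ, EnvRel Γ s ρ → Rel A (t.subst s) (F ρ)

theorem Realizes.inst {n : ℕ} {Γ : Ctx n} {A B : Form} {t : Term S (n + 1)}
    {F : Env S (n + 1) → Sem S B} (hF : Realizes (Ctx.cons A Γ) t B F)
    {G : Env S n → (Sem S A →ₗ[S] Sem S B)} (hG : ∀ ρ x, G ρ x = F (Env.cons x ρ))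
    {s : Fin n → Term S 0} {ρ : Env S n} (h : EnvRel Γ s ρ) (u : Term S 0) (x : Sem S A)
    (hu : Rel A u x) : Rel B ((t.subst (Term.liftSubst s)).inst u) (G ρ x) := by
  rw [Term.inst_subst_liftSubst, hG]
  exact hF _ _ (h.cons hu)

/-- Every proof-term is realised by a multilinear map. -/
theorem Typed.exists_realizes {n : ℕ} {Γ : Ctx n} {t : Term S n} {A : Form} (h : Typed Γ t A) :
    ∃ F : Env S n → Sem S A, IsMultilinearOn Γ F ∧ Realizes Γ t A F := by
  induction h with
  | ax x A => exact ⟨_, .var x A, fun s ρ h => h x A (if_pos rfl)⟩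
  | sum _ _ ih ih' =>
    obtain ⟨F, hF, hF'⟩ := ih
    obtain ⟨G, hG, hG'⟩ := ih'
    exact ⟨_, hF.fun_add hG, fun s ρ h => (hF' s ρ h).plus (hG' s ρ h)⟩
  | prod a _ ih =>
    obtain ⟨F, hF, hF'⟩ := ih
    exact ⟨fun ρ => a • F ρ, hF.comp (a • LinearMap.id), fun s ρ h => (hF' s ρ h).prod a⟩
  | top_i a =>
    -- A constant need not be linear in any variable; the empty context requires none.
    exact ⟨fun _ => (show S from a), ⟨fun _ _ _ _ => rfl, fun _ _ _ _ h => (h rfl).elim,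
      fun _ _ _ _ h => (h rfl).elim⟩, fun s ρ _ => Relation.EqvGen.refl _⟩
  | top_e hs _ _ ih ih' =>
    obtain ⟨F, hF, hF'⟩ := ih
    obtain ⟨G, hG, hG'⟩ := ih'
    -- Repackaging `hF` moves it along the unfolding of `Sem S Form.top` to `S`; the same device
    -- recurs below.
    exact ⟨_, IsMultilinearOn.bilin (M := S) ⟨hF.indep, hF.add, hF.smul⟩ hG hs (LinearMap.lsmul S _), fun s ρ h =>
      (hF' s ρ (hs.envRel h).1).elimTop (hG' s ρ (hs.envRel h).2)⟩
  | bot_e hs _ ih =>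
    obtain ⟨F, hF, hF'⟩ := ih
    -- Zero is linear in every variable, and nothing is related at `⊥`.
    exact ⟨_, .zero, fun s ρ h => (hF' s ρ (hs.envRel h).1).elim⟩
  | imp_i _ ih =>
    obtain ⟨F, hF, hF'⟩ := ih
    obtain ⟨G, hG, hGF⟩ := hF.curry
    exact ⟨G, ⟨hG.indep, hG.add, hG.smul⟩, fun s ρ h =>
      ⟨_, Relation.EqvGen.refl _, hF'.inst hGF h⟩⟩
  | @imp_e _ _ _ _ _ _ A B hs _ _ ih ih' =>
    obtain ⟨F, hF, hF'⟩ := ih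
    obtain ⟨G, hG, hG'⟩ := ih'
    exact ⟨_, IsMultilinearOn.bilin (M := Sem S A →ₗ[S] Sem S B) ⟨hF.indep, hF.add, hF.smul⟩ hG hs
      LinearMap.id, fun s ρ h => (hF' s ρ (hs.envRel h).1).app (hG' s ρ (hs.envRel h).2)⟩
  | and_i _ _ ih ih' =>
    obtain ⟨F, hF, hF'⟩ := ih
    obtain ⟨G, hG, hG'⟩ := ih'
    have H := hF.prodMk hG
    exact ⟨fun ρ => (F ρ, G ρ), ⟨H.indep, H.add, H.smul⟩, fun s ρ h =>
      ⟨_, _, Relation.EqvGen.refl _, hF' s ρ h, hG' s ρ h⟩⟩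
  | @and_e1 _ _ _ _ _ _ A B C hs _ _ ih ih' =>
    obtain ⟨F, hF, hF'⟩ := ih
    obtain ⟨G, hG, hG'⟩ := ih'
    obtain ⟨H, hH, hHG⟩ := hG.curry
    exact ⟨_, IsMultilinearOn.bilin (M := Sem S A × Sem S B) ⟨hF.indep, hF.add, hF.smul⟩ hH hs
      -- The bilinear map sends (p, φ) to φ(p.1), `LinearMap.id.flip` being evaluation.
      ((LinearMap.id.flip).comp (LinearMap.fst S _ _)), fun s ρ h =>
      Rel.elimAnd1 (hF' s ρ (hs.envRel h).1) (hG'.inst hHG (hs.envRel h).2)⟩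
  | @and_e2 _ _ _ _ _ _ A B C hs _ _ ih ih' =>
    obtain ⟨F, hF, hF'⟩ := ih
    obtain ⟨G, hG, hG'⟩ := ih'
    obtain ⟨H, hH, hHG⟩ := hG.curry
    exact ⟨_, IsMultilinearOn.bilin (M := Sem S A × Sem S B) ⟨hF.indep, hF.add, hF.smul⟩ hH hs
      ((LinearMap.id.flip).comp (LinearMap.snd S _ _)), fun s ρ h =>
      Rel.elimAnd2 (hF' s ρ (hs.envRel h).1) (hG'.inst hHG (hs.envRel h).2)⟩
  | @or_i1 _ _ _ A B _ ih =>
    obtain ⟨F, hF, hF'⟩ := ih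
    have H := hF.comp (LinearMap.inl S (Sem S A) (Sem S B))
    exact ⟨_, ⟨H.indep, H.add, H.smul⟩, fun s ρ h => OrRel.inl (hF' s ρ h)⟩
  | @or_i2 _ _ _ A B _ ih =>
    obtain ⟨F, hF, hF'⟩ := ih
    have H := hF.comp (LinearMap.inr S (Sem S A) (Sem S B))
    exact ⟨_, ⟨H.indep, H.add, H.smul⟩, fun s ρ h => OrRel.inr (hF' s ρ h)⟩
  | @or_e _ _ _ _ _ _ _ A B C hs _ _ _ ih ih' ih'' =>
    obtain ⟨F, hF, hF'⟩ := ih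
    obtain ⟨G₁, hG₁, hG₁'⟩ := ih'
    obtain ⟨G₂, hG₂, hG₂'⟩ := ih''
    obtain ⟨H₁, hH₁, hHG₁⟩ := hG₁.curry
    obtain ⟨H₂, hH₂, hHG₂⟩ := hG₂.curry
    exact ⟨_, IsMultilinearOn.bilin (M := Sem S A × Sem S B) ⟨hF.indep, hF.add, hF.smul⟩
      -- The branches share their context, so their pair is multilinear there; `coprodEquiv` makes
      -- it one linear map on the product.
      ((hH₁.prodMk hH₂).comp (LinearMap.coprodEquiv S).toLinearMap) hs LinearMap.id.flip,
      fun s ρ h => Rel.elimOr (hF' s ρ (hs.envRel h).1) (hG₁'.inst hHG₁ (hs.envRel h).2)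
        (hG₂'.inst hHG₂ (hs.envRel h).2)⟩

theorem IsClosedProof.exists_rel {t : Term S 0} {A : Form} (h : IsClosedProof t A) :
    ∃ x : Sem S A, Rel A t x := by
  obtain ⟨F, _, hF⟩ := Typed.exists_realizes h
  have := hF Term.var 0 fun x => x.elim0
  rw [Term.subst_var] at this
  exact ⟨_, this⟩

end FundamentalLemma

end LS

theorem mainTheorem3 {S : Type*} [Field S] (A B : LS.Form) (hB : LS.Form.IsVec B)
    (t u v : LS.Term S 0) (ht : LS.IsClosedProof t (LS.Form.imp A B))
    (hu : LS.IsClosedProof u A) (hv : LS.IsClosedProof v A) :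
    LS.Conv (LS.Term.app t (LS.Term.plus u v))
        (LS.Term.plus (LS.Term.app t u) (LS.Term.app t v)) ∧
      ∀ a : S, LS.Conv (LS.Term.app t (LS.Term.prod a u))
        (LS.Term.prod a (LS.Term.app t u)) := by
  obtain ⟨f, hf⟩ : ∃ f : LS.Sem S A →ₗ[S] LS.Sem S B, LS.Rel (A.imp B) t f := ht.exists_rel
  obtain ⟨x, hx⟩ := hu.exists_rel
  obtain ⟨y, hy⟩ := hv.exists_rel
  refine ⟨hB.conv_of_rel (hf.app (hx.plus hy)) ?_, fun a => hB.conv_of_rel (hf.app (hx.prod a)) ?_⟩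
  · rw [map_add]
    exact (hf.app hx).plus (hf.app hy)
  · rw [map_smul]
    exact (hf.app hx).prod a
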